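/- Let $a\in(0,\pi)$ and $\alpha\in\mathbb C$. Let $\mathcal H=\dot H^1_0(0,\pi)\times L^2(0,\pi)$ (complex-valued functions) be the Hilbert space with inner product $\langle\phi,\psi\rangle=\langle\phi_1',\psi_1'\rangle_{L^2}+\langle\phi_2,\psi_2\rangle_{L^2}$, and let $A(a,\alpha)$ be the unbounded operator in $\mathcal H$ given by $$A(a,\alpha)\begin{pmatrix}\psi_1\\ \psi_2\end{pmatrix}=\begin{pmatrix}\psi_2\\ \psi_1''\end{pmatrix},$$ $$\mathsf{dom}\,A(a,\alpha)=\Big\{\psi\in\big(\dot H^1_0(0,\pi)\cap H^2(0,a)\cap H^2(a,\pi)\big)\times\dot H^1_0(0,\pi)\ \Big|\ \psi_1'(a+)-\psi_1'(a-)=\alpha\,\psi_2(a)\Big\},$$ where $\psi_1''$ is taken on $(0,a)$ and on $(a,\pi)$ separately, and the jump condition is understood for the absolutely continuous representatives. Let $$S(\lambda;a,\alpha)=\frac1\lambda\Big(\sinh(\lambda\pi)+\alpha\sinh(\lambda a)\sinh(\lambda(\pi-a))\Big),$$ with the removable singularity at $\lambda=0$ filled by the limit $S(0;a,\alpha)=\pi$.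 Then $S(\cdot\,;a,\alpha)$ is an entire function, and a number $\lambda\in\mathbb C$ is an eigenvalue of $A(a,\alpha)$ if and only if $S(\lambda;a,\alpha)=0$. Moreover, for every eigenvalue $\lambda$ of $A(a,\alpha)$, the algebraic multiplicity of $\lambda$, that is, the dimension of the root subspace $\bigcup_{k\ge1}\ker\big(A(a,\alpha)-\lambda I\big)^k$, is finite and equals the multiplicity of $\lambda$ as a zero of $S(\cdot\,;a,\alpha)$. -/

import Mathlib

open MeasureTheory Set

noncomputable section

namespace DampedWave

/-- `H¹(c,d)` in dimension one: the absolutely continuous functions on `[c,d]` whose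
(almost everywhere defined) derivative is square integrable. Functions are identified with their
absolutely continuous representative. -/
def MemH1 (c d : ℝ) (u : ℝ → ℂ) : Prop :=
  AbsolutelyContinuousOnInterval u c d ∧ MemLp (deriv u) 2 (volume.restrict (Ioo c d))

/-- `H²(c,d)` in dimension one: the functions that are differentiable on `[c,d]` (one-sidedly at
the end points) and whose derivative belongs to `H¹(c,d)`; in particular they are `C¹` on `[c,d]`,
and `derivWithin u (Icc c d) c`, `derivWithin u (Icc c d) d` are the one-sided limits `u'(c+)`
and `u'(d-)` of the derivative. -/
def MemH2 (c d : ℝ) (u : ℝ → ℂ) : Prop :=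
  DifferentiableOn ℝ u (Icc c d) ∧ MemH1 c d (derivWithin u (Icc c d))

theorem ae_differentiableAt_of_ac {c d : ℝ} {u : ℝ → ℂ}
    (hu : AbsolutelyContinuousOnInterval u c d) :
    ∀ᵐ x ∂(volume.restrict (Ioo c d)), DifferentiableAt ℝ u x := by
  rw [ae_restrict_iff' measurableSet_Ioo]
  filter_upwards [hu.boundedVariationOn.locallyBoundedVariationOn.ae_differentiableWithinAt_of_mem]
    with x hx hxm
  have hm : uIcc c d ∈ nhds x :=
    Filter.mem_of_superset (Icc_mem_nhds hxm.1 hxm.2) Icc_subset_uIcc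
  exact (hx (mem_of_mem_nhds hm)).differentiableAt hm

theorem deriv_add_ae {c d : ℝ} {u v : ℝ → ℂ} (hu : AbsolutelyContinuousOnInterval u c d)
    (hv : AbsolutelyContinuousOnInterval v c d) :
    deriv (u + v) =ᵐ[volume.restrict (Ioo c d)] deriv u + deriv v := by
  filter_upwards [ae_differentiableAt_of_ac hu, ae_differentiableAt_of_ac hv] with x h1 h2
  exact deriv_add h1 h2

theorem deriv_smul_ae {c d : ℝ} {u : ℝ → ℂ} (k : ℂ)
    (hu : AbsolutelyContinuousOnInterval u c d) :
    deriv (k • u) =ᵐ[volume.restrict (Ioo c d)] k • deriv u := by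
  filter_upwards [ae_differentiableAt_of_ac hu] with x h1
  exact deriv_const_smul k h1

theorem ac_zero (c d : ℝ) : AbsolutelyContinuousOnInterval (0 : ℝ → ℂ) c d :=
  ContDiffOn.absolutelyContinuousOnInterval (contDiffOn_const (c := (0 : ℂ)))

theorem deriv_zero_fun : deriv (0 : ℝ → ℂ) = 0 := by
  funext x
  exact deriv_const x (0 : ℂ)

theorem MemH1.zero (c d : ℝ) : MemH1 c d 0 :=
  ⟨ac_zero c d, by rw [deriv_zero_fun]; exact MemLp.zero⟩

theorem MemH1.add {c d : ℝ} {u v : ℝ → ℂ} (hu : MemH1 c d u) (hv : MemH1 c d v) :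
    MemH1 c d (u + v) :=
  ⟨hu.1.add hv.1, (memLp_congr_ae (deriv_add_ae hu.1 hv.1)).2 (hu.2.add hv.2)⟩

theorem MemH1.smul {c d : ℝ} {u : ℝ → ℂ} (k : ℂ) (hu : MemH1 c d u) : MemH1 c d (k • u) :=
  ⟨hu.1.const_smul k, (memLp_congr_ae (deriv_smul_ae k hu.1)).2 (hu.2.const_smul k)⟩

theorem derivWithin_add_fun {s : Set ℝ} {u v : ℝ → ℂ} (hu : DifferentiableOn ℝ u s)
    (hv : DifferentiableOn ℝ v s) {x : ℝ} (hx : x ∈ s) :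
    derivWithin (u + v) s x = derivWithin u s x + derivWithin v s x :=
  derivWithin_add (hu x hx) (hv x hx)

theorem derivWithin_smul_fun {s : Set ℝ} {u : ℝ → ℂ} (k : ℂ) (x : ℝ) :
    derivWithin (k • u) s x = k * derivWithin u s x :=
  derivWithin_const_smul_field k u

theorem ac_congr {c d : ℝ} {u v : ℝ → ℂ} (hcd : c ≤ d) (h : EqOn u v (Icc c d))
    (hu : AbsolutelyContinuousOnInterval u c d) : AbsolutelyContinuousOnInterval v c d := by
  rw [absolutelyContinuousOnInterval_iff] at hu ⊢
  intro ε hε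
  obtain ⟨δ, hδ, H⟩ := hu ε hε
  refine ⟨δ, hδ, fun E hE hlt => ?_⟩
  have := H E hE hlt
  refine lt_of_eq_of_lt (Finset.sum_congr rfl fun i hi => ?_) this
  have hm := hE.1 i hi
  rw [uIcc_of_le hcd] at hm
  rw [h hm.1, h hm.2]

theorem MemH1.congr {c d : ℝ} {u v : ℝ → ℂ} (hcd : c ≤ d) (h : EqOn u v (Icc c d))
    (hu : MemH1 c d u) : MemH1 c d v := by
  refine ⟨ac_congr hcd h hu.1, (memLp_congr_ae ?_).1 hu.2⟩
  filter_upwards [ae_restrict_mem measurableSet_Ioo] with x hx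
  exact Filter.EventuallyEq.deriv_eq
    (Filter.eventuallyEq_of_mem (Icc_mem_nhds hx.1 hx.2) h)

theorem MemH2.add {c d : ℝ} {u v : ℝ → ℂ} (hcd : c ≤ d) (hu : MemH2 c d u) (hv : MemH2 c d v) :
    MemH2 c d (u + v) :=
  ⟨hu.1.add hv.1, (hu.2.add hv.2).congr hcd fun _ hx => (derivWithin_add_fun hu.1 hv.1 hx).symm⟩

theorem MemH2.smul {c d : ℝ} {u : ℝ → ℂ} (k : ℂ) (hcd : c ≤ d) (hu : MemH2 c d u) :
    MemH2 c d (k • u) :=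
  ⟨hu.1.const_smul k, (hu.2.smul k).congr hcd fun x _ => (derivWithin_smul_fun k x).symm⟩

theorem MemH2.zero {c d : ℝ} (hcd : c ≤ d) : MemH2 c d 0 := by
  refine ⟨differentiableOn_const (0 : ℂ), (MemH1.zero c d).congr hcd fun x _ => ?_⟩
  exact (congrFun (derivWithin_const (Icc c d) (0 : ℂ)) x).symm

theorem deriv_deriv_ae {c d : ℝ} (u : ℝ → ℂ) :
    deriv (derivWithin u (Icc c d)) =ᵐ[volume.restrict (Ioo c d)] deriv (deriv u) := by
  filter_upwards [ae_restrict_mem measurableSet_Ioo] with x hx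
  refine Filter.EventuallyEq.deriv_eq ?_
  filter_upwards [isOpen_Ioo.mem_nhds hx] with y hy
  exact derivWithin_of_mem_nhds (Icc_mem_nhds hy.1 hy.2)

theorem ae_Ioo_of_pieces {a : ℝ} {P : ℝ → Prop}
    (h1 : ∀ᵐ x ∂(volume.restrict (Ioo 0 a)), P x)
    (h2 : ∀ᵐ x ∂(volume.restrict (Ioo a Real.pi)), P x) :
    ∀ᵐ x ∂(volume.restrict (Ioo 0 Real.pi)), P x := by
  rw [ae_restrict_iff' measurableSet_Ioo] at h1 h2 ⊢
  filter_upwards [h1, h2, (measure_eq_zero_iff_ae_notMem.1 (Real.volume_singleton (a := a)))]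
    with x k1 k2 k3 hx
  rcases lt_trichotomy x a with h | h | h
  · exact k1 ⟨hx.1, h⟩
  · exact absurd h k3
  · exact k2 ⟨h, hx.2⟩

theorem memLp_Ioo_of_pieces {a : ℝ} {f : ℝ → ℂ} (hf : AEStronglyMeasurable f volume)
    (h1 : MemLp f 2 (volume.restrict (Ioo 0 a)))
    (h2 : MemLp f 2 (volume.restrict (Ioo a Real.pi))) :
    MemLp f 2 (volume.restrict (Ioo 0 Real.pi)) := by
  have key : ∀ s : Set ℝ, MemLp f 2 (volume.restrict s) ↔
      IntegrableOn (fun x => ‖f x‖ ^ 2) s := fun s =>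
    memLp_two_iff_integrable_sq_norm hf.restrict
  rw [key] at h1 h2 ⊢
  refine ((h1.union (integrableOn_singleton (x := a) (by finiteness) (by simp))).union h2).mono_set fun x hx => ?_
  rcases lt_trichotomy x a with h | h | h
  · exact Or.inl (Or.inl ⟨hx.1, h⟩)
  · exact Or.inl (Or.inr h)
  · exact Or.inr ⟨h, hx.2⟩

theorem memLp_deriv_deriv {a : ℝ} {u : ℝ → ℂ} (h1 : MemH2 0 a u) (h2 : MemH2 a Real.pi u) :
    MemLp (deriv (deriv u)) 2 (volume.restrict (Ioo 0 Real.pi)) :=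
  memLp_Ioo_of_pieces (stronglyMeasurable_deriv _).aestronglyMeasurable
    ((memLp_congr_ae (deriv_deriv_ae u)).1 h1.2.2) ((memLp_congr_ae (deriv_deriv_ae u)).1 h2.2.2)

/-- The space `L²(0,π)` of complex-valued functions. -/
abbrev L2 : Type := Lp ℂ 2 (volume.restrict (Ioo (0 : ℝ) Real.pi))

/-- The functions of `H¹(0,π)` with vanishing boundary values. An element is represented by its
absolutely continuous representative, extended by zero outside `(0,π)`; the condition at the points
`0` and `π` is the Dirichlet boundary condition. -/
def H01Submodule : Submodule ℂ (ℝ → ℂ) where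
  carrier := {u | MemH1 0 Real.pi u ∧ ∀ x, x ∉ Ioo 0 Real.pi → u x = 0}
  zero_mem' := ⟨MemH1.zero _ _, fun _ _ => rfl⟩
  add_mem' := fun hu hv => ⟨hu.1.add hv.1, fun x hx => by simp [hu.2 x hx, hv.2 x hx]⟩
  smul_mem' := fun k _ hu => ⟨hu.1.smul k, fun x hx => by simp [hu.2 x hx]⟩

/-- The space `Ḣ₀¹(0,π)`. -/
def H01 : Type := H01Submodule

instance : AddCommGroup H01 := inferInstanceAs (AddCommGroup H01Submodule)

instance : Module ℂ H01 := inferInstanceAs (Module ℂ H01Submodule)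

/-- The function `ℝ → ℂ` that represents an element of `Ḣ₀¹(0,π)`. -/
def H01.fn (u : H01) : ℝ → ℂ := Subtype.val (p := fun f => f ∈ H01Submodule) u

instance : CoeFun H01 (fun _ => ℝ → ℂ) := ⟨H01.fn⟩

theorem H01.add_fn (u v : H01) : (u + v).fn = u.fn + v.fn := rfl

theorem H01.smul_fn (k : ℂ) (u : H01) : (k • u).fn = k • u.fn := rfl

theorem H01.memH1 (u : H01) : MemH1 0 Real.pi u := u.2.1

theorem H01.eq_zero (u : H01) {x : ℝ} (hx : x ∉ Ioo 0 Real.pi) : u x = 0 := u.2.2 x hx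

theorem H01.ext {u v : H01} (h : ∀ x, u x = v x) : u = v := Subtype.ext (funext h)

theorem H01.continuousOn (u : H01) : ContinuousOn u (Icc 0 Real.pi) := by
  have := u.memH1.1.continuousOn
  rwa [uIcc_of_le Real.pi_pos.le] at this

theorem H01.memLp (u : H01) : MemLp u 2 (volume.restrict (Ioo 0 Real.pi)) := by
  have hc := u.continuousOn
  have h2 : MemLp u 2 (volume.restrict (Icc 0 Real.pi)) := by
    rw [memLp_two_iff_integrable_sq_norm (hc.aestronglyMeasurable measurableSet_Icc)]
    exact (hc.norm.pow 2).integrableOn_Icc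
  exact h2.mono_measure (Measure.restrict_mono Ioo_subset_Icc_self le_rfl)

/-- The derivative `u ↦ u'` as a map from `Ḣ₀¹(0,π)` to `L²(0,π)`. -/
def H01.derivL2 : H01 →ₗ[ℂ] L2 where
  toFun u := u.memH1.2.toLp (deriv u)
  map_add' u v := by
    rw [← MemLp.toLp_add]
    exact MemLp.toLp_congr _ _ (deriv_add_ae u.memH1.1 v.memH1.1)
  map_smul' k u := by
    rw [RingHom.id_apply, ← MemLp.toLp_const_smul]
    exact MemLp.toLp_congr _ _ (deriv_smul_ae k u.memH1.1)

/-- The embedding of `Ḣ₀¹(0,π)` into `L²(0,π)`. -/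
def H01.toL2 : H01 →ₗ[ℂ] L2 where
  toFun u := u.memLp.toLp u
  map_add' u v := (MemLp.toLp_add u.memLp v.memLp)
  map_smul' k u := (MemLp.toLp_const_smul k u.memLp)

theorem H01.derivL2_injective : Function.Injective H01.derivL2 := by
  rw [injective_iff_map_eq_zero]
  intro u hu
  have h0 : deriv u =ᵐ[volume.restrict (Ioo 0 Real.pi)] 0 :=
    (MemLp.toLp_eq_toLp_iff u.memH1.2 MemLp.zero).1 (by rw [MemLp.toLp_zero]; exact hu)
  have hd : ∀ᵐ x, x ∈ Ioo 0 Real.pi → HasDerivAt u 0 x := by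
    rw [← ae_restrict_iff' measurableSet_Ioo]
    filter_upwards [h0, ae_differentiableAt_of_ac u.memH1.1] with x h1 h2
    have := h2.hasDerivAt
    rwa [h1] at this
  have hd' : ∀ᵐ x, x ∈ uIcc 0 Real.pi → HasDerivAt u 0 x := by
    rw [uIcc_of_le Real.pi_pos.le]
    filter_upwards [hd, measure_eq_zero_iff_ae_notMem.1 (Real.volume_singleton (a := 0)),
      measure_eq_zero_iff_ae_notMem.1 (Real.volume_singleton (a := Real.pi))] with x k1 k2 k3 hx
    exact k1 ⟨lt_of_le_of_ne hx.1 (Ne.symm k2), lt_of_le_of_ne hx.2 k3⟩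
  obtain ⟨C, hC⟩ := u.memH1.1.const_of_ae_hasDerivAt_zero hd'
  have hC0 : C = 0 := by
    rw [← hC 0 left_mem_uIcc]
    exact u.eq_zero (by simp)
  refine H01.ext fun x => ?_
  change u x = 0
  by_cases hx : x ∈ Ioo 0 Real.pi
  · rw [hC x (by rw [uIcc_of_le Real.pi_pos.le]; exact Ioo_subset_Icc_self hx), hC0]
  · exact u.eq_zero hx

theorem H01.toL2_injective : Function.Injective H01.toL2 := by
  intro u v h
  have h0 : (u : ℝ → ℂ) =ᵐ[volume.restrict (Ioo 0 Real.pi)] v :=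
    (MemLp.toLp_eq_toLp_iff u.memLp v.memLp).1 h
  have h1 : EqOn (u : ℝ → ℂ) v (Ioo 0 Real.pi) :=
    Measure.eqOn_open_of_ae_eq h0 isOpen_Ioo (u.continuousOn.mono Ioo_subset_Icc_self)
      (v.continuousOn.mono Ioo_subset_Icc_self)
  refine H01.ext fun x => ?_
  by_cases hx : x ∈ Ioo 0 Real.pi
  · exact h1 hx
  · rw [u.eq_zero hx, v.eq_zero hx]

/-- The inner product `⟨u, v⟩ = ⟨u', v'⟩_{L²}` on `Ḣ₀¹(0,π)`. -/
@[reducible] def H01.core : InnerProductSpace.Core ℂ H01 where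
  inner u v := inner ℂ (H01.derivL2 u) (H01.derivL2 v)
  conj_inner_symm u v := inner_conj_symm _ _
  re_inner_nonneg u := inner_self_nonneg
  add_left u v w := by
    change inner ℂ _ _ = inner ℂ _ _ + inner ℂ _ _
    rw [map_add, inner_add_left]
  smul_left u v k := by
    change inner ℂ _ _ = _ * inner ℂ _ _
    rw [map_smul, inner_smul_left]
  definite u h := by
    have h' : H01.derivL2 u = 0 := inner_self_eq_zero.1 h
    exact H01.derivL2_injective (h'.trans (map_zero _).symm)

instance : NormedAddCommGroup H01 := H01.core.toNormedAddCommGroup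

instance : InnerProductSpace ℂ H01 := InnerProductSpace.ofCore H01.core.toCore

/-- The Hilbert space `Ḣ₀¹(0,π) × L²(0,π)` with the inner product
`⟨φ, ψ⟩ = ⟨φ₁', ψ₁'⟩_{L²} + ⟨φ₂, ψ₂⟩_{L²}`. -/
abbrev H : Type := WithLp 2 (H01 × L2)

/-- The domain of the wave operator `A(a, α)`: the pairs `(ψ₁, ψ₂)` with
`ψ₁ ∈ Ḣ₀¹(0,π) ∩ H²(0,a) ∩ H²(a,π)`, `ψ₂ ∈ Ḣ₀¹(0,π)` and `ψ₁'(a+) - ψ₁'(a-) = α ψ₂(a)`.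
Here `ψ₂` still is an element of `Ḣ₀¹(0,π)`, not of `L²(0,π)`. -/
def waveDom (a : Ioo 0 Real.pi) (α : ℂ) : Submodule ℂ (H01 × H01) where
  carrier := {ψ | MemH2 0 a ψ.1 ∧ MemH2 a Real.pi ψ.1 ∧
    derivWithin ψ.1 (Icc a Real.pi) a - derivWithin ψ.1 (Icc 0 a) a = α * ψ.2 a}
  zero_mem' := by
    refine ⟨MemH2.zero a.2.1.le, MemH2.zero a.2.2.le, ?_⟩
    change derivWithin (0 : ℝ → ℂ) _ _ - derivWithin (0 : ℝ → ℂ) _ _ = α * 0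
    simp
  add_mem' := by
    rintro φ ψ ⟨h1, h2, h3⟩ ⟨k1, k2, k3⟩
    refine ⟨h1.add a.2.1.le k1, h2.add a.2.2.le k2, ?_⟩
    have e1 := derivWithin_add_fun h1.1 k1.1 (right_mem_Icc.2 a.2.1.le)
    have e2 := derivWithin_add_fun h2.1 k2.1 (left_mem_Icc.2 a.2.2.le)
    change derivWithin ((φ.1 : ℝ → ℂ) + (ψ.1 : ℝ → ℂ)) _ _ -
      derivWithin ((φ.1 : ℝ → ℂ) + (ψ.1 : ℝ → ℂ)) _ _ = α * (φ.2 a + ψ.2 a)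
    rw [e1, e2]
    linear_combination h3 + k3
  smul_mem' := by
    rintro k ψ ⟨h1, h2, h3⟩
    refine ⟨h1.smul k a.2.1.le, h2.smul k a.2.2.le, ?_⟩
    change derivWithin (k • (ψ.1 : ℝ → ℂ)) _ _ - derivWithin (k • (ψ.1 : ℝ → ℂ)) _ _ =
      α * (k * ψ.2 a)
    rw [derivWithin_smul_fun, derivWithin_smul_fun]
    linear_combination k * h3

/-- The inclusion of the domain into the Hilbert space, `(ψ₁, ψ₂) ↦ (ψ₁, ψ₂)`. -/
def waveIncl (a : Ioo 0 Real.pi) (α : ℂ) : waveDom a α →ₗ[ℂ] H where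
  toFun ψ := WithLp.toLp 2 (ψ.1.1, H01.toL2 ψ.1.2)
  map_add' φ ψ := by
    rw [← WithLp.toLp_add]
    simp
  map_smul' k ψ := by
    rw [← WithLp.toLp_smul]
    simp

theorem waveIncl_injective (a : Ioo 0 Real.pi) (α : ℂ) : Function.Injective (waveIncl a α) := by
  intro φ ψ h
  have h' : (φ.1.1, H01.toL2 φ.1.2) = (ψ.1.1, H01.toL2 ψ.1.2) := WithLp.toLp_injective 2 h
  rw [Prod.mk.injEq] at h'
  exact Subtype.ext (Prod.ext h'.1 (H01.toL2_injective h'.2))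

/-- The map `(ψ₁, ψ₂) ↦ ψ₁'' ∈ L²(0,π)` on the domain, where `ψ₁''` is taken piecewise, on `(0,a)`
and on `(a,π)`. -/
def secondDeriv (a : Ioo 0 Real.pi) (α : ℂ) : waveDom a α →ₗ[ℂ] L2 where
  toFun ψ := (memLp_deriv_deriv ψ.2.1 ψ.2.2.1).toLp (deriv (deriv ψ.1.1))
  map_add' φ ψ := by
    rw [← MemLp.toLp_add]
    refine MemLp.toLp_congr _ _ ?_
    have aux : ∀ c d : ℝ, MemH2 c d φ.1.1 → MemH2 c d ψ.1.1 →
        deriv (deriv ((φ.1.1 : ℝ → ℂ) + (ψ.1.1 : ℝ → ℂ)))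
          =ᵐ[volume.restrict (Ioo c d)] deriv (deriv φ.1.1) + deriv (deriv ψ.1.1) := by
      intro c d h k
      filter_upwards [deriv_deriv_ae (c := c) (d := d) φ.1.1, deriv_deriv_ae (c := c) (d := d) ψ.1.1,
        deriv_add_ae h.2.1 k.2.1, ae_restrict_mem measurableSet_Ioo] with x e1 e2 e3 hx
      rw [Pi.add_apply, ← e1, ← e2, ← Pi.add_apply, ← e3]
      refine Filter.EventuallyEq.deriv_eq ?_
      filter_upwards [isOpen_Ioo.mem_nhds hx] with y hy
      have hm := Icc_mem_nhds hy.1 hy.2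
      rw [Pi.add_apply, derivWithin_of_mem_nhds hm, derivWithin_of_mem_nhds hm]
      exact deriv_add ((h.1 y (mem_of_mem_nhds hm)).differentiableAt hm)
        ((k.1 y (mem_of_mem_nhds hm)).differentiableAt hm)
    exact ae_Ioo_of_pieces (aux 0 a φ.2.1 ψ.2.1) (aux a Real.pi φ.2.2.1 ψ.2.2.1)
  map_smul' k ψ := by
    rw [RingHom.id_apply, ← MemLp.toLp_const_smul]
    refine MemLp.toLp_congr _ _ (Filter.Eventually.of_forall fun x => ?_)
    change deriv (deriv (k • (ψ.1.1 : ℝ → ℂ))) x = k • deriv (deriv ψ.1.1) x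
    have : deriv (k • (ψ.1.1 : ℝ → ℂ)) = k • deriv (ψ.1.1 : ℝ → ℂ) := by
      funext y
      exact deriv_const_smul_field k _
    rw [this]
    exact deriv_const_smul_field k _

/-- The action `(ψ₁, ψ₂) ↦ (ψ₂, ψ₁'')` of the wave operator. -/
def waveAct (a : Ioo 0 Real.pi) (α : ℂ) : waveDom a α →ₗ[ℂ] H where
  toFun ψ := WithLp.toLp 2 (ψ.1.2, secondDeriv a α ψ)
  map_add' φ ψ := by
    rw [← WithLp.toLp_add]
    simp
  map_smul' k ψ := by
    rw [← WithLp.toLp_smul]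
    simp

/-- The wave operator `A(a, α)` with Dirac damping, as an unbounded operator in the Hilbert
space `H`. -/
def waveOperator (a : Ioo 0 Real.pi) (α : ℂ) : H →ₗ.[ℂ] H where
  domain := LinearMap.range (waveIncl a α)
  toFun := waveAct a α ∘ₗ
    (LinearEquiv.ofInjective (waveIncl a α) (waveIncl_injective a α)).symm.toLinearMap

section Spectral

variable {E : Type*} [AddCommGroup E] [Module ℂ E]

/-- `z` is an eigenvalue of the unbounded operator `T`. -/
def IsEigenvalue (T : E →ₗ.[ℂ] E) (z : ℂ) : Prop :=
  ∃ x : T.domain, (x : E) ≠ 0 ∧ T x = z • (x : E)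

/-- The kernel of `(T - z)^k`, where `x` lies in the domain of `(T - z)^(k+1)` if `x` lies in the
domain of `T` and `(T - z) x` in the domain of `(T - z)^k`. -/
def kerPow (T : E →ₗ.[ℂ] E) (z : ℂ) : ℕ → Submodule ℂ E
  | 0 => ⊥
  | k + 1 => ((kerPow T z k).comap (T.toFun - z • T.domain.subtype)).map T.domain.subtype

/-- The root subspace of `T` at `z`, the union of the kernels of all powers `(T - z)^k`. -/
def rootSubspace (T : E →ₗ.[ℂ] E) (z : ℂ) : Submodule ℂ E := ⨆ k, kerPow T z k

/-- The algebraic multiplicity of `z`: the dimension of the root subspace, `⊤` if infinite. -/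
def algebraicMultiplicity (T : E →ₗ.[ℂ] E) (z : ℂ) : ℕ∞ :=
  Cardinal.toENat (Module.rank ℂ (rootSubspace T z))

theorem mem_kerPow_succ (T : E →ₗ.[ℂ] E) (z : ℂ) (k : ℕ) (x : E) :
    x ∈ kerPow T z (k + 1) ↔ ∃ hx : x ∈ T.domain, T ⟨x, hx⟩ - z • x ∈ kerPow T z k := by
  simp [kerPow]

end Spectral

/-- The function `S(z; a, α) = (sinh (z π) + α sinh (z a) sinh (z (π - a))) / z`, with its
removable singularity at `z = 0` filled by the limit `π`. -/
def charFun (a : ℝ) (α z : ℂ) : ℂ :=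
  if z = 0 then (Real.pi : ℂ)
  else (1 / z) * (Complex.sinh (z * Real.pi) +
    α * (Complex.sinh (z * a) * Complex.sinh (z * (Real.pi - a))))

end DampedWave

end

/-!
Let `U(w, x)` be `sinh (w x)` on `[0,a]` and `sinh (w x) + α sinh (w a) sinh (w (x - a))` on
`[a,π]`. The pair `F(w) = (U(w, ·), w U(w, ·))` is a formal eigenvector of `A(a, α)` for the
eigenvalue `w`: it satisfies the differential equation, the boundary condition at `0` and the jump
condition at `a`; the only condition it may violate is the one at `π`, where `U(w, π) = w S(w)`.

Let `z ≠ 0`, and let `m` be the order of `S` at `z`, which is finite because `S(0) = π ≠ 0`. The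
Taylor coefficients `F₁, F₂, …` of `F` at `z`, numbered from one, satisfy `(A - z) F_j = F_(j-1)`
with `F₀ = 0`. Their first components vanish at `π` for `j ≤ m`, but not for `j = m + 1`
(`exists_order_charFun`), so that `F₁, …, F_m` is a Jordan chain in the domain (`exists_isTaylorFamily`). Conversely, let `ψ` be
in the domain with `(A - z) ψ` in the span of `F₁, …, F_m`. Shifting indices up by one gives a
particular solution of the same equation, and the solution is unique up to multiples of `F₁`,
because the Cauchy problem from the left is uniquely solvable (`MemH2.eq_zero_of_ode`). Thus `ψ` is
a combination of `F₁, …, F_(m+1)`, and `ψ(π) = 0` removes the last term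
(`IsTaylorFamily.exists_eq_sum`). It follows that the root subspace is the span of `F₁, …, F_m`,
and these vectors are linearly independent (`algebraicMultiplicity_eq_of_chain`). For `m = 0` the
same argument shows that there is no eigenvector.

At `z = 0` the function `F` vanishes, but `0` is neither a zero of `S` nor an eigenvalue
(`not_isEigenvalue_zero`).

The Taylor coefficients are explicit: `U` is a combination of exponentials `exp (w y)`, whose
coefficients at `z` are `y ^ j / j! * exp (z y)` (`expCoeff`).
-/

noncomputable section

namespace DampedWave

/-! ### Jordan chains and the root subspace -/

section Chain

variable {E : Type*} [AddCommGroup E] [Module ℂ E]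

/-- A nilpotent shift `g (F j) = F (j - 1)` with `F 0 = 0 ≠ F 1` acts on linearly independent
vectors `F 1, F 2, …`. -/
theorem linearIndependent_of_shift {g : E →ₗ[ℂ] E} {F : ℕ → E} {m : ℕ} (h0 : F 0 = 0)
    (h1 : F 1 ≠ 0) (hg : ∀ j ≤ m, g (F j) = F (j - 1)) :
    LinearIndependent ℂ fun i : Fin m => F (i + 1) := by
  have key : ∀ n ≤ m, ∀ c : ℕ → ℂ, ∑ i ∈ Finset.range n, c i • F (i + 1) = 0 →
      ∀ i < n, c i = 0 := by
    intro n
    induction n with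
    | zero => simp
    | succ n ih =>
      intro hn c hc
      have h2 : ∑ i ∈ Finset.range n, c (i + 1) • F (i + 1) = 0 := by
        have := congrArg g hc
        rw [map_sum, map_zero, Finset.sum_congr rfl (g := fun i => c i • F i) fun i hi => by
          rw [map_smul, hg _ (by have := Finset.mem_range.1 hi; omega), Nat.add_sub_cancel],
          Finset.sum_range_succ', h0, smul_zero, add_zero] at this
        exact this
      have h3 := ih (by omega) (fun i => c (i + 1)) h2
      have h4 : c 0 = 0 := by
        rw [Finset.sum_range_succ', Finset.sum_eq_zero fun i hi => by
          rw [h3 i (Finset.mem_range.1 hi), zero_smul], zero_add] at hc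
        exact (smul_eq_zero.1 hc).resolve_right h1
      intro i hi
      cases i with
      | zero => exact h4
      | succ i => exact h3 i (by omega)
  rw [Fintype.linearIndependent_iff]
  intro c hc i
  have h := key m le_rfl (fun i => if h : i < m then c ⟨i, h⟩ else 0)
    (by rw [Finset.sum_range]; simpa using hc) i i.2
  simpa using h

/-- A Jordan chain `F 1, …, F m` of `T` at `z` spans the root subspace, and `m` is the algebraic
multiplicity, if every `x` with `(T - z) x` in its span lies in its span. -/
theorem algebraicMultiplicity_eq_of_chain {T : E →ₗ.[ℂ] E} {z : ℂ} {F : ℕ → E} {m : ℕ}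
    (h0 : F 0 = 0) (h1 : F 1 ≠ 0) (hdom : ∀ j ≤ m, F j ∈ T.domain)
    (hT : ∀ j (hj : j ≤ m), T ⟨F j, hdom j hj⟩ - z • F j = F (j - 1))
    (hspan : ∀ (x : T.domain) (c : ℕ → ℂ),
      T x - z • (x : E) = ∑ i ∈ Finset.range (m + 1), c i • F i →
      ∃ d : ℕ → ℂ, (x : E) = ∑ i ∈ Finset.range m, d i • F (i + 1)) :
    algebraicMultiplicity T z = m := by
  obtain ⟨g, hg⟩ := LinearMap.exists_extend (T.toFun - z • T.domain.subtype)
  have hgF : ∀ j ≤ m, g (F j) = F (j - 1) := fun j hj =>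
    (LinearMap.congr_fun hg ⟨F j, hdom j hj⟩).trans (hT j hj)
  have hli := linearIndependent_of_shift h0 h1 hgF
  have hmem : ∀ j ≤ m, F j ∈ kerPow T z j := by
    intro j
    induction j with
    | zero => intro _; rw [h0]; exact zero_mem _
    | succ j ih =>
      intro hj
      rw [mem_kerPow_succ]
      refine ⟨hdom _ hj, ?_⟩
      rw [hT _ hj]
      exact ih (by omega)
  have hle : ∀ k, kerPow T z k ≤ Submodule.span ℂ (range fun i : Fin m => F (i + 1)) := by
    intro k
    induction k with
    | zero => exact bot_le
    | succ k ih =>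
      intro x hx
      obtain ⟨hxd, hx⟩ := (mem_kerPow_succ T z k x).1 hx
      obtain ⟨c, hc⟩ := (Submodule.mem_span_range_iff_exists_fun ℂ).1 (ih hx)
      obtain ⟨d, hd⟩ := hspan ⟨x, hxd⟩ (fun i => if h : i - 1 < m then c ⟨i - 1, h⟩ else 0) (by
        rw [Finset.sum_range_succ', h0, smul_zero, add_zero, Finset.sum_range]
        simpa using hc.symm)
      rw [Submodule.mem_span_range_iff_exists_fun]
      exact ⟨fun i => d i, by rw [← Finset.sum_range fun i => d i • F (i + 1)]; exact hd.symm⟩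
  have hroot : rootSubspace T z = Submodule.span ℂ (range fun i : Fin m => F (i + 1)) := by
    refine le_antisymm (iSup_le hle) (Submodule.span_le.2 ?_)
    rintro _ ⟨i, rfl⟩
    exact (le_iSup (kerPow T z) _) (hmem (i + 1) i.2)
  have hrank : Module.rank ℂ (rootSubspace T z) = m := by
    rw [hroot, rank_eq_card_basis (Module.Basis.span hli), Fintype.card_fin]
  rw [algebraicMultiplicity, hrank, Cardinal.toENat_nat]

end Chain

/-! ### The equation `u'' = z² u` in `H²(c,d)` -/

theorem MemH2.hasDerivWithinAt {c d : ℝ} {u : ℝ → ℂ} (hu : MemH2 c d u) {x : ℝ}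
    (hx : x ∈ Icc c d) : HasDerivWithinAt u (derivWithin u (Icc c d) x) (Icc c d) x :=
  (hu.1 x hx).hasDerivWithinAt

theorem contDiff_cexp_mul (z : ℂ) : ContDiff ℝ 1 fun x : ℝ => Complex.exp (z * x) :=
  (contDiff_const.mul Complex.ofRealCLM.contDiff).cexp

theorem hasDerivAt_cexp_mul (z : ℂ) (x : ℝ) :
    HasDerivAt (fun x : ℝ => Complex.exp (z * x)) (z * Complex.exp (z * x)) x := by
  have := ((hasDerivAt_id (x : ℂ)).const_mul z).cexp.comp_ofReal
  simpa [mul_comm] using this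

/-- Uniqueness for `v'' = z² v` with zero Cauchy data at the left end point, for `v ∈ H²(c,d)`.
The equation factors as `(d/dx + z) (d/dx - z) v = 0`, so that first `exp (z x) (v' - z v)` and
then `exp (-z x) v` is constant. -/
theorem MemH2.eq_zero_of_ode {c d : ℝ} (hcd : c < d) {v : ℝ → ℂ} (hv : MemH2 c d v) (z : ℂ)
    (hode : ∀ᵐ x ∂(volume.restrict (Ioo c d)), deriv (deriv v) x = z ^ 2 * v x)
    (h0 : v c = 0) (h1 : derivWithin v (Icc c d) c = 0) : ∀ x ∈ Icc c d, v x = 0 := by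
  set p := derivWithin v (Icc c d) with hp
  have huIcc : uIcc c d = Icc c d := uIcc_of_le hcd.le
  -- `v` is absolutely continuous, being `C¹` on `[c,d]`
  have hvac : AbsolutelyContinuousOnInterval v c d := by
    refine ContDiffOn.absolutelyContinuousOnInterval ?_
    rw [huIcc, contDiffOn_one_iff_derivWithin (uniqueDiffOn_Icc hcd)]
    exact ⟨hv.1, huIcc ▸ hv.2.1.continuousOn⟩
  set q : ℝ → ℂ := fun x => Complex.exp (z * x) * (p x - z * v x) with hq
  have hqac : AbsolutelyContinuousOnInterval q c d :=
    ((contDiff_cexp_mul z).contDiffOn.absolutelyContinuousOnInterval).smul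
      (hv.2.1.sub (hvac.const_smul z))
  have hqd : ∀ᵐ x, x ∈ uIcc c d → HasDerivAt q 0 x := by
    have h2 : ∀ᵐ x, x ∈ Ioo c d → HasDerivAt q 0 x := by
      rw [← ae_restrict_iff' measurableSet_Ioo]
      filter_upwards [hode, deriv_deriv_ae (c := c) (d := d) v, ae_differentiableAt_of_ac hv.2.1,
        ae_restrict_mem measurableSet_Ioo] with x e1 e2 e3 hx
      have hm := Icc_mem_nhds hx.1 hx.2
      have d1 : HasDerivAt v (p x) x := (hv.hasDerivWithinAt (mem_of_mem_nhds hm)).hasDerivAt hm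
      have d2 : HasDerivAt p (z ^ 2 * v x) x := by
        rw [← e1, ← e2]; exact e3.hasDerivAt
      convert! (hasDerivAt_cexp_mul z x).mul (d2.sub (d1.const_mul z)) using 1
      simp only [Pi.sub_apply]
      ring
    rw [huIcc]
    filter_upwards [h2, measure_eq_zero_iff_ae_notMem.1 (Real.volume_singleton (a := c)),
      measure_eq_zero_iff_ae_notMem.1 (Real.volume_singleton (a := d))] with x k1 k2 k3 hx
    exact k1 ⟨lt_of_le_of_ne hx.1 (Ne.symm k2), lt_of_le_of_ne hx.2 k3⟩
  obtain ⟨C, hC⟩ := hqac.const_of_ae_hasDerivAt_zero hqd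
  have hC0 : C = 0 := by
    rw [← hC c left_mem_uIcc]
    simp [hq, h0, h1]
  have hpv : ∀ x ∈ Icc c d, p x = z * v x := by
    intro x hx
    have := hC x (huIcc ▸ hx)
    simp only [hq, hC0, mul_eq_zero, Complex.exp_ne_zero, false_or] at this
    exact sub_eq_zero.1 this
  have hr : ∀ x ∈ Icc c d,
      HasDerivWithinAt (fun x : ℝ => Complex.exp (-z * x) * v x) 0 (Icc c d) x := by
    intro x hx
    convert! (hasDerivAt_cexp_mul (-z) x).hasDerivWithinAt.mul (hv.hasDerivWithinAt hx) using 1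
    rw [← hp, hpv x hx]
    ring
  intro x hx
  have := constant_of_derivWithin_zero (fun y hy => (hr y hy).differentiableWithinAt)
    (fun y hy => (hr y (Ico_subset_Icc_self hy)).derivWithin
      (uniqueDiffOn_Icc hcd y (Ico_subset_Icc_self hy))) x hx
  simpa [h0, Complex.exp_ne_zero] using this

theorem MemH2.of_eqOn_contDiff {c d : ℝ} (hcd : c < d) {u p : ℝ → ℂ} (hp : ContDiff ℝ 2 p)
    (h : EqOn u p (Icc c d)) : MemH2 c d u := by
  have hd : ∀ x ∈ Icc c d, derivWithin u (Icc c d) x = deriv p x := by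
    intro x hx
    rw [derivWithin_congr h (h hx)]
    exact (hp.differentiable (by decide) x).derivWithin (uniqueDiffOn_Icc hcd x hx)
  have hp1 : ContDiff ℝ 1 (deriv p) := hp.iterate_deriv' 1 1
  refine ⟨hp.differentiable (by decide) |>.differentiableOn.congr h, ?_⟩
  refine MemH1.congr hcd.le (fun x hx => (hd x hx).symm)
    ⟨hp1.contDiffOn.absolutelyContinuousOnInterval, ?_⟩
  have hc : Continuous (deriv (deriv p)) := hp1.continuous_deriv le_rfl
  have : MemLp (deriv (deriv p)) 2 (volume.restrict (Icc c d)) := by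
    rw [memLp_two_iff_integrable_sq_norm hc.aestronglyMeasurable]
    exact (hc.norm.pow 2).continuousOn.integrableOn_Icc
  exact this.mono_measure (Measure.restrict_mono Ioo_subset_Icc_self le_rfl)

theorem derivWithin_eq_of_eqOn {c d : ℝ} (hcd : c < d) {u p : ℝ → ℂ} {p' : ℂ} {x : ℝ}
    (hx : x ∈ Icc c d) (h : EqOn u p (Icc c d)) (hp : HasDerivAt p p' x) :
    derivWithin u (Icc c d) x = p' := by
  rw [derivWithin_congr h (h hx)]
  exact hp.hasDerivWithinAt.derivWithin (uniqueDiffOn_Icc hcd x hx)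

/-- If `u ∈ H²(c,d)` and a `C²` function `p` have the same Cauchy data at `c` and solve
`u'' - z² u = f = p'' - z² p`, then they coincide. -/
theorem MemH2.eqOn_of_ode {c d : ℝ} (hcd : c < d) {u p p1 p2 f : ℝ → ℂ} (hu : MemH2 c d u) (z : ℂ)
    (hp : ContDiff ℝ 2 p) (hp1 : ∀ x, HasDerivAt p (p1 x) x) (hp2 : ∀ x, HasDerivAt p1 (p2 x) x)
    (hpf : ∀ x ∈ Icc c d, p2 x = z ^ 2 * p x + f x)
    (hode : ∀ᵐ x ∂(volume.restrict (Ioo c d)), deriv (deriv u) x = z ^ 2 * u x + f x)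
    (h0 : u c = p c) (h1 : derivWithin u (Icc c d) c = p1 c) : EqOn u p (Icc c d) := by
  have hpH : MemH2 c d p := MemH2.of_eqOn_contDiff hcd hp fun _ _ => rfl
  have hv : MemH2 c d (u + (-1 : ℂ) • p) := hu.add hcd.le (hpH.smul (-1) hcd.le)
  have hc : c ∈ Icc c d := left_mem_Icc.2 hcd.le
  have hdw : ∀ x ∈ Icc c d, derivWithin (u + (-1 : ℂ) • p) (Icc c d) x =
      derivWithin u (Icc c d) x - p1 x := by
    intro x hx
    rw [derivWithin_add_fun hu.1 (hpH.smul (-1) hcd.le).1 hx, derivWithin_smul_fun,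
      derivWithin_eq_of_eqOn hcd hx (fun _ _ => rfl) (hp1 x)]
    ring
  have hz := hv.eq_zero_of_ode hcd z (by
    filter_upwards [hode, deriv_deriv_ae (c := c) (d := d) u,
      deriv_deriv_ae (c := c) (d := d) (u + (-1 : ℂ) • p), ae_differentiableAt_of_ac hu.2.1,
      ae_restrict_mem measurableSet_Ioo] with x e1 e2 e3 e4 hx
    rw [← e3]
    have e5 := e4.hasDerivAt
    rw [e2, e1] at e5
    have e6 : HasDerivAt (derivWithin (u + (-1 : ℂ) • p) (Icc c d))
        (z ^ 2 * u x + f x - p2 x) x := by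
      refine (e5.sub (hp2 x)).congr_of_eventuallyEq ?_
      filter_upwards [Icc_mem_nhds hx.1 hx.2] with y hy using hdw y hy
    rw [e6.deriv, hpf x (Ioo_subset_Icc_self hx)]
    simp only [Pi.add_apply, Pi.smul_apply, smul_eq_mul]
    ring) (by simp [h0]) (by rw [hdw c hc, h1, sub_self])
  intro x hx
  have := hz x hx
  simp only [Pi.add_apply, Pi.smul_apply, smul_eq_mul] at this
  linear_combination this

/-! ### Piecewise smooth functions and the wave operator -/

/-- A continuous function on `[0,π]` that vanishes at the end points and coincides with `C²`
functions on `[0,a]` and on `[a,π]` is an element of `Ḣ₀¹(0,π)`. -/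
theorem exists_H01_of_pieces (a : Ioo 0 Real.pi) {p q : ℝ → ℂ} (hp : ContDiff ℝ 2 p)
    (hq : ContDiff ℝ 2 q) (hp0 : p 0 = 0) (hpq : p a = q a) (hq0 : q Real.pi = 0) :
    ∃ u : H01, EqOn u p (Icc 0 a) ∧ EqOn u q (Icc a Real.pi) := by
  obtain ⟨a, ha⟩ := a
  have ha0 : (0 : ℝ) ≤ a := ha.1.le
  have haπ : a ≤ Real.pi := ha.2.le
  set U : ℝ → ℂ := fun x => if x ≤ 0 then 0 else if x ≤ a then p x else
    if x < Real.pi then q x else 0 with hU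
  have hUp : EqOn U p (Icc 0 a) := by
    intro x hx
    rcases hx.1.eq_or_lt with h | h
    · simp [hU, ← h, hp0]
    · simp [hU, not_le.2 h, hx.2]
  have hUq : EqOn U q (Icc a Real.pi) := by
    intro x hx
    rcases hx.1.eq_or_lt with h | h
    · rw [← h]; simp [hU, not_le.2 ha.1, hpq]
    · rcases hx.2.eq_or_lt with k | k
      · rw [k]; simp [hU, not_le.2 ha.2, not_le.2 Real.pi_pos, hq0]
      · simp [hU, not_le.2 (ha.1.trans h), not_le.2 h, k]
  have hUac : AbsolutelyContinuousOnInterval U 0 Real.pi := by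
    obtain ⟨K, hK⟩ := (hp.of_le (by decide : (1 : WithTop ℕ∞) ≤ 2)).contDiffOn
      (s := Icc 0 a) |>.exists_lipschitzOnWith (by decide) (convex_Icc _ _) isCompact_Icc
    obtain ⟨L, hL⟩ := (hq.of_le (by decide : (1 : WithTop ℕ∞) ≤ 2)).contDiffOn
      (s := Icc a Real.pi) |>.exists_lipschitzOnWith (by decide) (convex_Icc _ _) isCompact_Icc
    have h1 : LipschitzOnWith K (fun x => p (min x a)) (uIcc 0 Real.pi) := by
      rw [uIcc_of_le Real.pi_pos.le]
      have := hK.comp (LipschitzWith.id.min_const a |>.lipschitzOnWith (s := Icc 0 Real.pi))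
        (fun x hx => ⟨le_min hx.1 ha0, min_le_right _ _⟩)
      simpa using! this
    have h2 : LipschitzOnWith L (fun x => q (max x a)) (uIcc 0 Real.pi) := by
      rw [uIcc_of_le Real.pi_pos.le]
      have := hL.comp (LipschitzWith.id.max_const a |>.lipschitzOnWith (s := Icc 0 Real.pi))
        (fun x hx => ⟨le_max_right _ _, max_le hx.2 haπ⟩)
      simpa using! this
    have h3 : AbsolutelyContinuousOnInterval (fun _ : ℝ => p a) 0 Real.pi :=
      contDiffOn_const.absolutelyContinuousOnInterval
    -- on `[0,π]` the function is `p (min x a) + q (max x a) - p a`, a sum of Lipschitz functions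
    refine ac_congr Real.pi_pos.le (fun x hx => ?_)
      ((h1.absolutelyContinuousOnInterval.add h2.absolutelyContinuousOnInterval).sub h3)
    simp only [Pi.add_apply, Pi.sub_apply]
    rcases le_total x a with h | h
    · rw [min_eq_left h, max_eq_right h, hUp ⟨hx.1, h⟩, ← hpq, add_sub_cancel_right]
    · rw [min_eq_right h, max_eq_left h, hUq ⟨h, hx.2⟩, add_sub_cancel_left]
  have hUd : MemLp (deriv U) 2 (volume.restrict (Ioo 0 Real.pi)) := by
    have aux : ∀ {c d : ℝ} {r : ℝ → ℂ}, ContDiff ℝ 2 r → EqOn U r (Icc c d) →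
        MemLp (deriv U) 2 (volume.restrict (Ioo c d)) := by
      intro c d r hr h
      have hc : Continuous (deriv r) := hr.continuous_deriv (by decide)
      have h1 : MemLp (deriv r) 2 (volume.restrict (Icc c d)) := by
        rw [memLp_two_iff_integrable_sq_norm hc.aestronglyMeasurable]
        exact (hc.norm.pow 2).continuousOn.integrableOn_Icc
      refine (memLp_congr_ae ?_).1
        (h1.mono_measure (Measure.restrict_mono Ioo_subset_Icc_self le_rfl))
      filter_upwards [ae_restrict_mem measurableSet_Ioo] with x hx
      exact (Filter.eventuallyEq_of_mem (Icc_mem_nhds hx.1 hx.2) h).deriv_eq.symm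
    exact memLp_Ioo_of_pieces (stronglyMeasurable_deriv _).aestronglyMeasurable
      (aux hp hUp) (aux hq hUq)
  refine ⟨⟨U, ⟨hUac, hUd⟩, fun x hx => ?_⟩, hUp, hUq⟩
  by_cases h : x ≤ 0
  · simp [hU, h]
  · have h' : Real.pi ≤ x := not_lt.1 fun k => hx ⟨not_le.1 h, k⟩
    simp [hU, h, not_le.2 (ha.2.trans_le h'), not_lt.2 h']

theorem waveOperator_apply (a : Ioo 0 Real.pi) (α : ℂ) (ψ : waveDom a α)
    (h : waveIncl a α ψ ∈ (waveOperator a α).domain) :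
    waveOperator a α ⟨waveIncl a α ψ, h⟩ = waveAct a α ψ := by
  change waveAct a α ((LinearEquiv.ofInjective (waveIncl a α)
    (waveIncl_injective a α)).symm ⟨waveIncl a α ψ, h⟩) = _
  congr 1
  rw [LinearEquiv.symm_apply_eq]
  rfl

/-- `(A - z) ψ = χ` written out for functions. -/
theorem waveAct_sub_smul_eq_iff (a : Ioo 0 Real.pi) (α z : ℂ) (ψ χ : waveDom a α) :
    waveAct a α ψ - z • waveIncl a α ψ = waveIncl a α χ ↔
      (∀ x, ψ.1.2 x = z * ψ.1.1 x + χ.1.1 x) ∧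
      ∀ᵐ x ∂(volume.restrict (Ioo 0 Real.pi)),
        deriv (deriv ψ.1.1) x = z * ψ.1.2 x + χ.1.2 x := by
  have h1 : waveAct a α ψ - z • waveIncl a α ψ = waveIncl a α χ ↔
      ψ.1.2 - z • ψ.1.1 = χ.1.1 ∧
        secondDeriv a α ψ - z • H01.toL2 ψ.1.2 = H01.toL2 χ.1.2 := by
    rw [← Prod.mk.injEq]
    exact (WithLp.toLp_injective 2).eq_iff
  rw [h1]
  refine and_congr ⟨fun h x => ?_, fun h => H01.ext fun x => ?_⟩ ?_
  · have := congrArg (fun u : H01 => u.fn x) h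
    change ψ.1.2 x - z * ψ.1.1 x = χ.1.1 x at this
    linear_combination this
  · change ψ.1.2 x - z * ψ.1.1 x = χ.1.1 x
    rw [h x]; ring
  · rw [sub_eq_iff_eq_add, ← map_smul, ← map_add]
    refine (MemLp.toLp_eq_toLp_iff (memLp_deriv_deriv ψ.2.1 ψ.2.2.1)
      (χ.1.2 + z • ψ.1.2).memLp).trans ?_
    refine Filter.eventually_congr (Filter.Eventually.of_forall fun x => ?_)
    change _ = χ.1.2 x + z * ψ.1.2 x ↔ _
    rw [add_comm]

/-! ### Taylor coefficients of the solution and of the characteristic function -/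

/-- The Taylor coefficients of `w ↦ exp (w y)` at `z`, with the index shifted by one: the value at
`j + 1` is the coefficient `y ^ j / j! * exp (z y)` of order `j`, and the value at `0` is `0`. With
this convention the recursion `expCoeff z (j - 1)` makes sense for all `j`. -/
def expCoeff (z : ℂ) : ℕ → ℝ → ℂ
  | 0, _ => 0
  | j + 1, y => (y : ℂ) ^ j / (j.factorial : ℂ) * Complex.exp (z * y)

theorem hasDerivAt_expCoeff (z : ℂ) (j : ℕ) (y : ℝ) :
    HasDerivAt (expCoeff z j) (z * expCoeff z j y + expCoeff z (j - 1) y) y := by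
  match j with
  | 0 => simpa [expCoeff] using! hasDerivAt_const y (0 : ℂ)
  | 1 =>
    have h : expCoeff z 1 = fun y : ℝ => Complex.exp (z * y) := by
      funext y; simp [expCoeff]
    rw [h]
    simpa [expCoeff] using hasDerivAt_cexp_mul z y
  | j + 2 =>
    have h1 : HasDerivAt (fun y : ℝ => (y : ℂ) ^ (j + 1) / ((j + 1).factorial : ℂ))
        ((y : ℂ) ^ j / (j.factorial : ℂ)) y := by
      have := ((hasDerivAt_id (y : ℂ)).pow (j + 1)).comp_ofReal.div_const ((j + 1).factorial : ℂ)
      convert! this using 1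
      have : (j.factorial : ℂ) ≠ 0 := by exact_mod_cast j.factorial_ne_zero
      have : (j + 1 : ℂ) ≠ 0 := by exact_mod_cast j.succ_ne_zero
      rw [Nat.factorial_succ]
      push_cast
      field_simp
      simp
    convert! h1.mul (hasDerivAt_cexp_mul z y) using 1
    simp only [expCoeff, show j + 2 - 1 = j + 1 from rfl]
    ring

theorem iteratedDeriv_cexp_mul (n : ℕ) (y : ℝ) (z : ℂ) :
    iteratedDeriv n (fun w : ℂ => Complex.exp (w * y)) z = n.factorial * expCoeff z (n + 1) y := by
  have h := congrFun (iteratedDeriv_cexp_const_mul n (y : ℂ)) z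
  simp only [mul_comm (y : ℂ)] at h
  rw [h, expCoeff]
  have : (n.factorial : ℂ) ≠ 0 := by exact_mod_cast n.factorial_ne_zero
  field_simp

/-- The Taylor coefficients at `z` (index shifted by one) of the solution `w ↦ sinh (w x)` of
`u'' = w² u` on `[0,a]`. -/
def leftCoeff (z : ℂ) (j : ℕ) (x : ℝ) : ℂ := (expCoeff z j x - expCoeff z j (-x)) / 2

/-- The Taylor coefficients at `z` (index shifted by one) of the continuation
`w ↦ sinh (w x) + α sinh (w a) sinh (w (x - a))` of that solution to `[a,π]`, the product of
hyperbolic sines being expanded into exponentials. -/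
def rightCoeff (a : ℝ) (α z : ℂ) (j : ℕ) (x : ℝ) : ℂ :=
  leftCoeff z j x + α / 4 * (expCoeff z j x + expCoeff z j (-x) -
    expCoeff z j (2 * a - x) - expCoeff z j (-(2 * a) + x))

/-- The derivative of `leftCoeff`. -/
def leftCoeffDeriv (z : ℂ) (j : ℕ) (x : ℝ) : ℂ :=
  ((z * expCoeff z j x + expCoeff z (j - 1) x) +
    (z * expCoeff z j (-x) + expCoeff z (j - 1) (-x))) / 2

/-- The derivative of `rightCoeff`. -/
def rightCoeffDeriv (a : ℝ) (α z : ℂ) (j : ℕ) (x : ℝ) : ℂ :=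
  leftCoeffDeriv z j x + α / 4 * ((z * expCoeff z j x + expCoeff z (j - 1) x) -
    (z * expCoeff z j (-x) + expCoeff z (j - 1) (-x)) +
    (z * expCoeff z j (2 * a - x) + expCoeff z (j - 1) (2 * a - x)) -
    (z * expCoeff z j (-(2 * a) + x) + expCoeff z (j - 1) (-(2 * a) + x)))

/-- A family `e 0 = 0, e 1, e 2, …` with derivatives `e'`, that solves the equations
`(z² - d²/dx²) (e j) = - 2 z e (j - 1) - e (j - 2)` for the Taylor coefficients at `z`
of an analytic family of solutions of `u'' = w² u`. -/
structure IsWaveChain (z : ℂ) (e e' : ℕ → ℝ → ℂ) : Prop where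
  zero : ∀ x, e 0 x = 0
  hasDerivAt : ∀ j x, HasDerivAt (e j) (e' j x) x
  hasDerivAt' : ∀ j x, HasDerivAt (e' j)
    (z * (z * e j x + e (j - 1) x) + (z * e (j - 1) x + e (j - 1 - 1) x)) x

theorem hasDerivAt_expCoeff_comp_neg (z : ℂ) (j : ℕ) (c x : ℝ) :
    HasDerivAt (fun x => expCoeff z j (c - x))
      (-(z * expCoeff z j (c - x) + expCoeff z (j - 1) (c - x))) x :=
  (hasDerivAt_expCoeff z j (c - x)).comp_const_sub c x

theorem hasDerivAt_expCoeff_comp_add (z : ℂ) (j : ℕ) (c x : ℝ) :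
    HasDerivAt (fun x => expCoeff z j (c + x))
      (z * expCoeff z j (c + x) + expCoeff z (j - 1) (c + x)) x :=
  (hasDerivAt_expCoeff z j (c + x)).comp_const_add c x

theorem hasDerivAt_expCoeff_neg (z : ℂ) (j : ℕ) (x : ℝ) :
    HasDerivAt (fun x => expCoeff z j (-x))
      (-(z * expCoeff z j (-x) + expCoeff z (j - 1) (-x))) x := by
  simpa using hasDerivAt_expCoeff_comp_neg z j 0 x

theorem isWaveChain_leftCoeff (z : ℂ) : IsWaveChain z (leftCoeff z) (leftCoeffDeriv z) where
  zero x := by simp [leftCoeff, expCoeff]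
  hasDerivAt j x := by
    convert! ((hasDerivAt_expCoeff z j x).sub (hasDerivAt_expCoeff_neg z j x)).div_const 2 using 1
    simp only [leftCoeffDeriv]
    ring
  hasDerivAt' j x := by
    convert! ((((hasDerivAt_expCoeff z j x).const_mul z).add (hasDerivAt_expCoeff z (j - 1) x)).add
      (((hasDerivAt_expCoeff_neg z j x).const_mul z).add
        (hasDerivAt_expCoeff_neg z (j - 1) x))).div_const 2 using 1
    simp only [leftCoeff]
    ring

theorem isWaveChain_rightCoeff (a : ℝ) (α z : ℂ) :
    IsWaveChain z (rightCoeff a α z) (rightCoeffDeriv a α z) where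
  zero x := by simp [rightCoeff, leftCoeff, expCoeff]
  hasDerivAt j x := by
    convert! ((isWaveChain_leftCoeff z).hasDerivAt j x).add
      (((((hasDerivAt_expCoeff z j x).add (hasDerivAt_expCoeff_neg z j x)).sub
        (hasDerivAt_expCoeff_comp_neg z j (2 * a) x)).sub
        (hasDerivAt_expCoeff_comp_add z j (-(2 * a)) x)).const_mul (α / 4)) using 1
    simp only [rightCoeffDeriv]
    ring
  hasDerivAt' j x := by
    have d1 := fun i => hasDerivAt_expCoeff z i x
    have d2 := fun i => hasDerivAt_expCoeff_neg z i x
    have d3 := fun i => hasDerivAt_expCoeff_comp_neg z i (2 * a) x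
    have d4 := fun i => hasDerivAt_expCoeff_comp_add z i (-(2 * a)) x
    convert! ((isWaveChain_leftCoeff z).hasDerivAt' j x).add
      ((((((d1 j).const_mul z).add (d1 (j - 1))).sub (((d2 j).const_mul z).add (d2 (j - 1)))).add
        (((d3 j).const_mul z).add (d3 (j - 1)))).sub
        (((d4 j).const_mul z).add (d4 (j - 1))) |>.const_mul (α / 4)) using 1
    simp only [rightCoeff]
    ring

theorem IsWaveChain.contDiff {z : ℂ} {e e' : ℕ → ℝ → ℂ} (he : IsWaveChain z e e') (j : ℕ) :
    ContDiff ℝ 2 (e j) := by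
  have hd : ∀ j, deriv (e j) = e' j := fun j => funext fun x => (he.hasDerivAt j x).deriv
  have hd' : ∀ j, deriv (e' j) = fun x =>
      z * (z * e j x + e (j - 1) x) + (z * e (j - 1) x + e (j - 1 - 1) x) :=
    fun j => funext fun x => (he.hasDerivAt' j x).deriv
  have hc : ∀ j, Continuous (e j) := fun j =>
    continuous_iff_continuousAt.2 fun x => (he.hasDerivAt j x).continuousAt
  rw [show (2 : WithTop ℕ∞) = 1 + 1 by norm_num, contDiff_succ_iff_deriv]
  refine ⟨fun x => (he.hasDerivAt j x).differentiableAt, by simp, ?_⟩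
  rw [hd, contDiff_one_iff_deriv, hd']
  refine ⟨fun x => (he.hasDerivAt' j x).differentiableAt, ?_⟩
  have h0 := hc j
  have h1 := hc (j - 1)
  have h2 := hc (j - 1 - 1)
  fun_prop

theorem leftCoeff_at_zero (z : ℂ) (j : ℕ) : leftCoeff z j 0 = 0 := by simp [leftCoeff]

theorem leftCoeffDeriv_one_at_zero (z : ℂ) : leftCoeffDeriv z 1 0 = z := by
  simp [leftCoeffDeriv, expCoeff]

theorem rightCoeff_at_jump (a : ℝ) (α z : ℂ) (j : ℕ) :
    rightCoeff a α z j a = leftCoeff z j a := by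
  rw [rightCoeff, show 2 * a - a = a by ring, show -(2 * a) + a = -a by ring]
  ring

theorem rightCoeffDeriv_at_jump (a : ℝ) (α z : ℂ) (j : ℕ) :
    rightCoeffDeriv a α z j a - leftCoeffDeriv z j a =
      α * (z * leftCoeff z j a + leftCoeff z (j - 1) a) := by
  rw [rightCoeffDeriv, show 2 * a - a = a by ring, show -(2 * a) + a = -a by ring]
  simp only [leftCoeff]
  ring

/-- The entire function `z S(z; a, α)`. -/
def sinhSum (a : ℝ) (α z : ℂ) : ℂ :=
  Complex.sinh (z * Real.pi) + α * (Complex.sinh (z * a) * Complex.sinh (z * (Real.pi - a)))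

theorem sinhSum_eq_exp (a : ℝ) (α z : ℂ) :
    sinhSum a α z = 1 / 2 * Complex.exp (z * (Real.pi : ℝ)) +
      (-1 / 2 * Complex.exp (z * (-Real.pi : ℝ)) +
      (α / 4 * Complex.exp (z * (Real.pi : ℝ)) + (α / 4 * Complex.exp (z * (-Real.pi : ℝ)) +
      (-α / 4 * Complex.exp (z * (2 * a - Real.pi : ℝ)) +
        -α / 4 * Complex.exp (z * (-(2 * a) + Real.pi : ℝ)))))) := by
  rw [sinhSum]
  simp only [Complex.sinh]
  have e1 : Complex.exp (z * (2 * a - Real.pi : ℝ)) =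
      Complex.exp (z * a) * Complex.exp (-(z * (Real.pi - a))) := by
    rw [← Complex.exp_add]; push_cast; ring_nf
  have e2 : Complex.exp (z * (-(2 * a) + Real.pi : ℝ)) =
      Complex.exp (-(z * a)) * Complex.exp (z * (Real.pi - a)) := by
    rw [← Complex.exp_add]; push_cast; ring_nf
  have e3 : Complex.exp (z * (Real.pi : ℝ)) =
      Complex.exp (z * a) * Complex.exp (z * (Real.pi - a)) := by
    rw [← Complex.exp_add]; ring_nf
  have e4 : Complex.exp (z * (-Real.pi : ℝ)) =
      Complex.exp (-(z * a)) * Complex.exp (-(z * (Real.pi - a))) := by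
    rw [← Complex.exp_add]; push_cast; ring_nf
  rw [e1, e2, e4, e3, show -(z * (Real.pi : ℂ)) = -(z * a) + -(z * (Real.pi - a)) by ring,
    Complex.exp_add]
  ring

theorem iteratedDeriv_sinhSum (a : ℝ) (α z : ℂ) (n : ℕ) :
    iteratedDeriv n (sinhSum a α) z = n.factorial * rightCoeff a α z (n + 1) Real.pi := by
  have hs : ∀ (c : ℂ) (y : ℝ), ContDiffAt ℂ n (fun w : ℂ => c * Complex.exp (w * y)) z := by
    intro c y
    fun_prop
  have hd : ∀ (c : ℂ) (y : ℝ), iteratedDeriv n (fun w : ℂ => c * Complex.exp (w * y)) z =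
      c * (n.factorial * expCoeff z (n + 1) y) := by
    intro c y
    rw [iteratedDeriv_const_mul_field, iteratedDeriv_cexp_mul]
  have h6 := hs (-α / 4) (-(2 * a) + Real.pi)
  have h5 := (hs (-α / 4) (2 * a - Real.pi)).add h6
  have h4 := (hs (α / 4) (-Real.pi)).add h5
  have h3 := (hs (α / 4) Real.pi).add h4
  have h2 := (hs (-1 / 2) (-Real.pi)).add h3
  rw [show sinhSum a α = _ from funext (sinhSum_eq_exp a α)]
  refine (iteratedDeriv_add (hs (1 / 2) Real.pi) h2).trans ?_
  erw [iteratedDeriv_add (hs (-1 / 2) (-Real.pi)) h3, iteratedDeriv_add (hs (α / 4) Real.pi) h4,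
    iteratedDeriv_add (hs (α / 4) (-Real.pi)) h5,
    iteratedDeriv_add (hs (-α / 4) (2 * a - Real.pi)) h6]
  simp only [hd, rightCoeff, leftCoeff]
  ring

theorem differentiable_sinhSum (a : ℝ) (α : ℂ) : Differentiable ℂ (sinhSum a α) := by
  unfold sinhSum
  fun_prop

theorem charFun_eq_dslope (a : ℝ) (α : ℂ) : charFun a α = dslope (sinhSum a α) 0 := by
  funext z
  rcases eq_or_ne z 0 with rfl | hz
  · have hl : ∀ c : ℂ, HasDerivAt (fun z : ℂ => Complex.sinh (z * c)) c 0 := fun c => by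
      simpa using ((hasDerivAt_id (0 : ℂ)).mul_const c).csinh
    have := (hl Real.pi).add (((hl a).mul (hl (Real.pi - a))).const_mul α)
    have h2 : HasDerivAt (sinhSum a α) (Real.pi : ℂ) 0 := by
      convert! this using 1
      simp
    rw [dslope_same, h2.deriv, charFun, if_pos rfl]
  · rw [dslope_of_ne _ hz, slope_def_field, charFun, if_neg hz]
    simp only [sinhSum, zero_mul, Complex.sinh_zero, mul_zero, add_zero, sub_zero]
    ring

theorem differentiable_charFun (a : ℝ) (α : ℂ) : Differentiable ℂ (charFun a α) := by
  rw [charFun_eq_dslope, ← differentiableOn_univ,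
    Complex.differentiableOn_dslope Filter.univ_mem, differentiableOn_univ]
  exact differentiable_sinhSum a α

theorem sinhSum_eq_mul (a : ℝ) (α : ℂ) : sinhSum a α = id * charFun a α := by
  funext z
  rcases eq_or_ne z 0 with rfl | hz
  · simp [sinhSum]
  · simp only [Pi.mul_apply, id, charFun, if_neg hz, sinhSum]
    field_simp

/-- The order of a zero `z ≠ 0` of `S` in terms of the values of the Taylor coefficients of the
solution at the right end point `π`. -/
theorem exists_order_charFun (a : ℝ) (α : ℂ) {z : ℂ} (hz : z ≠ 0) :
    ∃ m : ℕ, analyticOrderAt (charFun a α) z = m ∧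
      (∀ j ≤ m, rightCoeff a α z j Real.pi = 0) ∧ rightCoeff a α z (m + 1) Real.pi ≠ 0 := by
  have hS : AnalyticOnNhd ℂ (charFun a α) univ :=
    (differentiable_charFun a α).differentiableOn.analyticOnNhd isOpen_univ
  have h0 : analyticOrderAt (charFun a α) 0 ≠ ⊤ := by
    have : analyticOrderAt (charFun a α) 0 = 0 := by
      rw [(hS 0 trivial).analyticOrderAt_eq_zero, charFun, if_pos rfl]
      exact_mod_cast Real.pi_ne_zero
    simp [this]
  obtain ⟨m, hm⟩ := ENat.ne_top_iff_exists.1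
    (hS.analyticOrderAt_ne_top_of_isPreconnected isPreconnected_univ (mem_univ 0) (mem_univ z) h0)
  have hord : analyticOrderAt (sinhSum a α) z = m := by
    rw [sinhSum_eq_mul, analyticOrderAt_mul analyticAt_id (hS z trivial), ← hm,
      analyticAt_id.analyticOrderAt_eq_zero.2 hz, zero_add]
  have hf : AnalyticAt ℂ (sinhSum a α) z :=
    (differentiable_sinhSum a α).analyticAt z
  rw [analyticOrderAt_eq_nat_iff_iteratedDeriv_eq_zero hf] at hord
  simp only [iteratedDeriv_sinhSum, mul_eq_zero, ne_eq, Nat.cast_eq_zero, Nat.factorial_ne_zero,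
    false_or] at hord
  refine ⟨m, hm.symm, fun j hj => ?_, hord.2⟩
  cases j with
  | zero => exact (isWaveChain_rightCoeff a α z).zero _
  | succ j => exact hord.1 j hj

/-! ### Jordan chains of the wave operator -/

theorem IsWaveChain.hasDerivAt_sum {z : ℂ} {e e' : ℕ → ℝ → ℂ} (he : IsWaveChain z e e') (n : ℕ)
    (c : ℕ → ℂ) (x : ℝ) :
    HasDerivAt (fun x => ∑ i ∈ Finset.range n, c i * e (i + 1) x)
      (∑ i ∈ Finset.range n, c i * e' (i + 1) x) x :=
  HasDerivAt.fun_sum fun i _ => (he.hasDerivAt (i + 1) x).const_mul (c i)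

/-- The wave equation with a linear combination of chain vectors on the right-hand side is solved
by shifting the indices up by one, and the solution in `H²(c,d)` is unique for given Cauchy data
at the left end point. -/
theorem IsWaveChain.eqOn_sum {z : ℂ} {e e' : ℕ → ℝ → ℂ} (he : IsWaveChain z e e') {c d : ℝ}
    (hcd : c < d) {u w : ℝ → ℂ} (hu : MemH2 c d u) (n : ℕ) (k : ℕ → ℂ)
    (hw : ∀ x ∈ Icc c d, w x = z * u x + ∑ i ∈ Finset.range n, k i * e i x)
    (hode : ∀ᵐ x ∂(volume.restrict (Ioo c d)), deriv (deriv u) x =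
      z * w x + ∑ i ∈ Finset.range n, k i * (z * e i x + e (i - 1) x))
    (h0 : u c = ∑ i ∈ Finset.range n, k i * e (i + 1) c)
    (h1 : derivWithin u (Icc c d) c = ∑ i ∈ Finset.range n, k i * e' (i + 1) c) :
    EqOn u (fun x => ∑ i ∈ Finset.range n, k i * e (i + 1) x) (Icc c d) := by
  refine hu.eqOn_of_ode hcd z
    (f := fun x => ∑ i ∈ Finset.range n, k i * (2 * z * e i x + e (i - 1) x))
    (p1 := fun x => ∑ i ∈ Finset.range n, k i * e' (i + 1) x)
    (ContDiff.sum fun i _ => contDiff_const.mul (he.contDiff (i + 1)))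
    (he.hasDerivAt_sum n k)
    (fun x => HasDerivAt.fun_sum fun i _ => (he.hasDerivAt' (i + 1) x).const_mul (k i))
    (fun x _ => ?_) ?_ h0 h1
  · rw [Finset.mul_sum, ← Finset.sum_add_distrib]
    refine Finset.sum_congr rfl fun i _ => ?_
    rw [Nat.add_sub_cancel]
    ring
  · filter_upwards [hode, ae_restrict_mem measurableSet_Ioo] with x hx hxm
    rw [hx, hw x (Ioo_subset_Icc_self hxm), mul_add, add_assoc, Finset.mul_sum,
      ← Finset.sum_add_distrib]
    refine congrArg₂ _ (by ring) (Finset.sum_congr rfl fun i _ => ?_)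
    ring

/-- The second derivative on `(c,d)` of the restriction of a twice differentiable function. -/
theorem ae_deriv_deriv_eq {c d : ℝ} {u p p1 p2 : ℝ → ℂ} (h : EqOn u p (Icc c d))
    (h1 : ∀ x, HasDerivAt p (p1 x) x) (h2 : ∀ x, HasDerivAt p1 (p2 x) x) :
    ∀ᵐ x ∂(volume.restrict (Ioo c d)), deriv (deriv u) x = p2 x := by
  filter_upwards [ae_restrict_mem measurableSet_Ioo] with x hx
  have h3 : deriv u =ᶠ[nhds x] p1 := by
    filter_upwards [isOpen_Ioo.mem_nhds hx] with y hy
    rw [(Filter.eventuallyEq_of_mem (Icc_mem_nhds hy.1 hy.2) h).deriv_eq, (h1 y).deriv]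
  rw [h3.deriv_eq, (h2 x).deriv]

/-- The value of the first component at a point, as a linear functional. -/
def evalFst (a : Ioo 0 Real.pi) (α : ℂ) (x : ℝ) : waveDom a α →ₗ[ℂ] ℂ where
  toFun ψ := ψ.1.1 x
  map_add' _ _ := rfl
  map_smul' _ _ := rfl

/-- The value of the second component at a point, as a linear functional. -/
def evalSnd (a : Ioo 0 Real.pi) (α : ℂ) (x : ℝ) : waveDom a α →ₗ[ℂ] ℂ where
  toFun ψ := ψ.1.2 x
  map_add' _ _ := rfl
  map_smul' _ _ := rfl

theorem waveDom_ext {a : Ioo 0 Real.pi} {α : ℂ} {φ ψ : waveDom a α}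
    (h1 : ∀ x, evalFst a α x φ = evalFst a α x ψ) (h2 : ∀ x, evalSnd a α x φ = evalSnd a α x ψ) :
    φ = ψ :=
  Subtype.ext (Prod.ext (H01.ext h1) (H01.ext h2))

/-- `G 0 = 0, G 1, …, G m` are the Taylor coefficients at `z` of the analytic family of formal
eigenvectors that satisfies all conditions but the one at `π`. -/
structure IsTaylorFamily (a : Ioo 0 Real.pi) (α z : ℂ) (m : ℕ) (G : ℕ → waveDom a α) : Prop where
  zero : G 0 = 0
  left : ∀ j ≤ m, EqOn (fun x => evalFst a α x (G j)) (leftCoeff z j) (Icc 0 a)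
  right : ∀ j ≤ m, EqOn (fun x => evalFst a α x (G j)) (rightCoeff a α z j) (Icc a Real.pi)
  snd : ∀ j ≤ m, ∀ x, evalSnd a α x (G j) =
    z * evalFst a α x (G j) + evalFst a α x (G (j - 1))

/-- The Taylor coefficients belong to the domain as long as they vanish at `π`. -/
theorem exists_isTaylorFamily (a : Ioo 0 Real.pi) (α z : ℂ) {m : ℕ}
    (hm : ∀ j ≤ m, rightCoeff a α z j Real.pi = 0) : ∃ G, IsTaylorFamily a α z m G := by
  have hL := isWaveChain_leftCoeff z
  have hR := isWaveChain_rightCoeff a α z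
  have hu : ∀ j, ∃ u : H01, j ≤ m →
      EqOn u (leftCoeff z j) (Icc 0 a) ∧ EqOn u (rightCoeff a α z j) (Icc a Real.pi) := by
    intro j
    by_cases hj : j ≤ m
    · obtain ⟨u, h⟩ := exists_H01_of_pieces a (hL.contDiff j) (hR.contDiff j)
        (leftCoeff_at_zero z j) (rightCoeff_at_jump a α z j).symm (hm j hj)
      exact ⟨u, fun _ => h⟩
    · exact ⟨0, fun h => absurd h hj⟩
  choose u hu using hu
  have hzero : u 0 = 0 := by
    refine H01.ext fun x => ?_
    change u 0 x = 0
    by_cases hx : x ∈ Ioo 0 Real.pi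
    · rcases le_total x a with h | h
      · rw [(hu 0 m.zero_le).1 ⟨hx.1.le, h⟩, hL.zero]
      · rw [(hu 0 m.zero_le).2 ⟨h, hx.2.le⟩, hR.zero]
    · exact H01.eq_zero _ hx
  have hdom : ∀ j ≤ m, (u j, z • u j + u (j - 1)) ∈ waveDom a α := by
    intro j hj
    have haL : (a : ℝ) ∈ Icc 0 (a : ℝ) := right_mem_Icc.2 a.2.1.le
    refine ⟨MemH2.of_eqOn_contDiff a.2.1 (hL.contDiff j) (hu j hj).1,
      MemH2.of_eqOn_contDiff a.2.2 (hR.contDiff j) (hu j hj).2, ?_⟩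
    change derivWithin (u j) _ _ - derivWithin (u j) _ _ = α * (z * u j a + u (j - 1) a)
    rw [derivWithin_eq_of_eqOn a.2.2 (left_mem_Icc.2 a.2.2.le) (hu j hj).2 (hR.hasDerivAt j a),
      derivWithin_eq_of_eqOn a.2.1 haL (hu j hj).1 (hL.hasDerivAt j a),
      (hu j hj).1 haL, (hu (j - 1) (by omega)).1 haL, rightCoeffDeriv_at_jump]
  have hval : ∀ j (hj : j ≤ m), (if h : j ≤ m then ⟨_, hdom j h⟩ else 0 : waveDom a α) =
      ⟨_, hdom j hj⟩ := fun j hj => dif_pos hj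
  refine ⟨fun j => if h : j ≤ m then ⟨_, hdom j h⟩ else 0, ?_, fun j hj => ?_, fun j hj => ?_,
    fun j hj x => ?_⟩
  · refine (hval 0 m.zero_le).trans (Subtype.ext (Prod.ext hzero ?_))
    change z • u 0 + u (0 - 1) = 0
    rw [Nat.zero_sub, hzero, smul_zero, add_zero]
  · simp only [hval j hj]
    exact (hu j hj).1
  · simp only [hval j hj]
    exact (hu j hj).2
  · simp only [hval j hj, hval (j - 1) (by omega)]
    rfl

/-- `(A - z) (G j) = G (j - 1)`. -/
theorem IsTaylorFamily.waveAct_sub {a : Ioo 0 Real.pi} {α z : ℂ} {m : ℕ} {G : ℕ → waveDom a α}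
    (hG : IsTaylorFamily a α z m G) {j : ℕ} (hj : j ≤ m) :
    waveAct a α (G j) - z • waveIncl a α (G j) = waveIncl a α (G (j - 1)) := by
  rw [waveAct_sub_smul_eq_iff]
  have hj1 : j - 1 ≤ m := by omega
  have hj2 : j - 1 - 1 ≤ m := by omega
  refine ⟨hG.snd j hj, ae_Ioo_of_pieces (a := a) ?_ ?_⟩
  · have hL := isWaveChain_leftCoeff z
    filter_upwards [ae_deriv_deriv_eq (hG.left j hj) (hL.hasDerivAt j) (hL.hasDerivAt' j),
      ae_restrict_mem measurableSet_Ioo] with x hx hxm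
    have hm := Ioo_subset_Icc_self hxm
    rw [← hG.left j hj hm, ← hG.left _ hj1 hm, ← hG.left _ hj2 hm] at hx
    refine hx.trans ?_
    change _ = z * evalSnd a α x (G j) + evalSnd a α x (G (j - 1))
    rw [hG.snd j hj, hG.snd _ hj1]
  · have hR := isWaveChain_rightCoeff a α z
    filter_upwards [ae_deriv_deriv_eq (hG.right j hj) (hR.hasDerivAt j) (hR.hasDerivAt' j),
      ae_restrict_mem measurableSet_Ioo] with x hx hxm
    have hm := Ioo_subset_Icc_self hxm
    rw [← hG.right j hj hm, ← hG.right _ hj1 hm, ← hG.right _ hj2 hm] at hx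
    refine hx.trans ?_
    change _ = z * evalSnd a α x (G j) + evalSnd a α x (G (j - 1))
    rw [hG.snd j hj, hG.snd _ hj1]

theorem IsTaylorFamily.one_ne_zero {a : Ioo 0 Real.pi} {α z : ℂ} {m : ℕ} {G : ℕ → waveDom a α}
    (hG : IsTaylorFamily a α z m G) (hm : 1 ≤ m) (hz : z ≠ 0) : G 1 ≠ 0 := by
  intro h
  have h1 := derivWithin_eq_of_eqOn a.2.1 (left_mem_Icc.2 a.2.1.le) (hG.left 1 hm)
    ((isWaveChain_leftCoeff z).hasDerivAt 1 0)
  simp only [h, map_zero, derivWithin_fun_const, leftCoeffDeriv_one_at_zero] at h1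
  exact hz h1.symm

/-- If `(A - z) ψ` is a combination of `G 1, …, G m`, then so is `ψ`, provided that the next
Taylor coefficient does not vanish at `π`. By unique solvability of the Cauchy problem from the
left, `ψ` is a combination of the coefficients with indices `1, …, m + 1`, and its vanishing at
`π` rules out the last one. -/
theorem IsTaylorFamily.exists_eq_sum {a : Ioo 0 Real.pi} {α z : ℂ} {m : ℕ} {G : ℕ → waveDom a α}
    (hG : IsTaylorFamily a α z m G) (hz : z ≠ 0) (hπ : ∀ j ≤ m, rightCoeff a α z j Real.pi = 0)
    (hπ' : rightCoeff a α z (m + 1) Real.pi ≠ 0) (ψ : waveDom a α) (c : ℕ → ℂ)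
    (hψ : waveAct a α ψ - z • waveIncl a α ψ =
      waveIncl a α (∑ i ∈ Finset.range (m + 1), c i • G i)) :
    ∃ d : ℕ → ℂ, ψ = ∑ i ∈ Finset.range m, d i • G (i + 1) := by
  have hL := isWaveChain_leftCoeff z
  have hR := isWaveChain_rightCoeff a α z
  -- The coefficient of `G 0 = 0` is free, it is chosen to match the initial slope of `ψ`.
  obtain ⟨k, hk, hslope⟩ : ∃ k : ℕ → ℂ,
      ∑ i ∈ Finset.range (m + 1), c i • G i = ∑ i ∈ Finset.range (m + 1), k i • G i ∧
      derivWithin ψ.1.1 (Icc 0 a) 0 =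
        ∑ i ∈ Finset.range (m + 1), k i * leftCoeffDeriv z (i + 1) 0 := by
    refine ⟨fun i => if i = 0 then (derivWithin ψ.1.1 (Icc 0 a) 0 -
      ∑ i ∈ Finset.range m, c (i + 1) * leftCoeffDeriv z (i + 1 + 1) 0) / z else c i, ?_, ?_⟩
    · simp [Finset.sum_range_succ', hG.zero]
    · simp only [Finset.sum_range_succ', Nat.add_one_ne_zero, if_false, if_true,
        zero_add, leftCoeffDeriv_one_at_zero]
      field_simp
      ring
  rw [hk, waveAct_sub_smul_eq_iff] at hψ
  obtain ⟨hψ1, hψ2⟩ := hψ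
  have hF : ∀ x, (∑ i ∈ Finset.range (m + 1), k i • G i).1.1 x =
      ∑ i ∈ Finset.range (m + 1), k i * evalFst a α x (G i) := fun x => by
    change evalFst a α x _ = _
    simp only [map_sum, map_smul, smul_eq_mul]
  have hS : ∀ x, (∑ i ∈ Finset.range (m + 1), k i • G i).1.2 x =
      ∑ i ∈ Finset.range (m + 1), k i * (z * evalFst a α x (G i) +
        evalFst a α x (G (i - 1))) := fun x => by
    change evalSnd a α x _ = _
    simp only [map_sum, map_smul, smul_eq_mul]
    exact Finset.sum_congr rfl fun i hi => by
      rw [hG.snd i (Nat.lt_succ_iff.1 (Finset.mem_range.1 hi))]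
  simp only [hF] at hψ1
  simp only [hS] at hψ2
  have hle : ∀ i ∈ Finset.range (m + 1), i ≤ m := fun i hi =>
    Nat.lt_succ_iff.1 (Finset.mem_range.1 hi)
  have hle' : ∀ i ∈ Finset.range (m + 1), i - 1 ≤ m := fun i hi => by
    have := hle i hi
    omega
  have hwL : ∀ x ∈ Icc 0 (a : ℝ), ψ.1.2 x =
      z * ψ.1.1 x + ∑ i ∈ Finset.range (m + 1), k i * leftCoeff z i x := by
    intro x hx
    rw [hψ1 x]
    exact congrArg _ (Finset.sum_congr rfl fun i hi => congrArg _ (hG.left i (hle i hi) hx))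
  have hwR : ∀ x ∈ Icc (a : ℝ) Real.pi, ψ.1.2 x =
      z * ψ.1.1 x + ∑ i ∈ Finset.range (m + 1), k i * rightCoeff a α z i x := by
    intro x hx
    rw [hψ1 x]
    exact congrArg _ (Finset.sum_congr rfl fun i hi => congrArg _ (hG.right i (hle i hi) hx))
  have hodeL : ∀ᵐ x ∂(volume.restrict (Ioo 0 (a : ℝ))), deriv (deriv ψ.1.1) x = z * ψ.1.2 x +
      ∑ i ∈ Finset.range (m + 1), k i * (z * leftCoeff z i x + leftCoeff z (i - 1) x) := by
    filter_upwards [ae_restrict_of_ae_restrict_of_subset (Ioo_subset_Ioo_right a.2.2.le) hψ2,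
      ae_restrict_mem measurableSet_Ioo] with x hx hxm
    have hm := Ioo_subset_Icc_self hxm
    rw [hx]
    exact congrArg _ (Finset.sum_congr rfl fun i hi => congrArg _ (congrArg₂ _
      (congrArg _ (hG.left i (hle i hi) hm)) (hG.left _ (hle' i hi) hm)))
  have hodeR : ∀ᵐ x ∂(volume.restrict (Ioo (a : ℝ) Real.pi)), deriv (deriv ψ.1.1) x =
      z * ψ.1.2 x + ∑ i ∈ Finset.range (m + 1),
        k i * (z * rightCoeff a α z i x + rightCoeff a α z (i - 1) x) := by
    filter_upwards [ae_restrict_of_ae_restrict_of_subset (Ioo_subset_Ioo_left a.2.1.le) hψ2,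
      ae_restrict_mem measurableSet_Ioo] with x hx hxm
    have hm := Ioo_subset_Icc_self hxm
    rw [hx]
    exact congrArg _ (Finset.sum_congr rfl fun i hi => congrArg _ (congrArg₂ _
      (congrArg _ (hG.right i (hle i hi) hm)) (hG.right _ (hle' i hi) hm)))
  have haL : (a : ℝ) ∈ Icc 0 (a : ℝ) := right_mem_Icc.2 a.2.1.le
  have hπR : Real.pi ∈ Icc (a : ℝ) Real.pi := right_mem_Icc.2 a.2.2.le
  have eL := hL.eqOn_sum a.2.1 ψ.2.1 (m + 1) k hwL hodeL
    (by simp [leftCoeff_at_zero, H01.eq_zero]) hslope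
  -- continuity and the jump condition at `a` provide the Cauchy data for `[a,π]`
  have eR := hR.eqOn_sum a.2.2 ψ.2.2.1 (m + 1) k hwR hodeR
    ((eL haL).trans (Finset.sum_congr rfl fun i _ => by rw [rightCoeff_at_jump])) (by
      have hdL := derivWithin_eq_of_eqOn a.2.1 haL eL (hL.hasDerivAt_sum (m + 1) k a)
      rw [sub_eq_iff_eq_add.1 ψ.2.2.2, hdL, hwL a haL, eL haL]
      simp only [Finset.mul_sum, ← Finset.sum_add_distrib]
      refine Finset.sum_congr rfl fun i _ => ?_
      have := rightCoeffDeriv_at_jump a α z (i + 1)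
      rw [Nat.add_sub_cancel] at this
      linear_combination -k i * this)
  -- at `π` only the term with index `m + 1` survives
  have hkm : k m = 0 := by
    have h := eR hπR
    simp only [Finset.sum_range_succ] at h
    rw [H01.eq_zero _ (by simp), Finset.sum_eq_zero fun i hi => by
      rw [hπ (i + 1) (Finset.mem_range.1 hi), mul_zero], zero_add] at h
    exact (mul_eq_zero.1 h.symm).resolve_right hπ'
  have hfst : ∀ x, evalFst a α x ψ = ∑ i ∈ Finset.range m, k i * evalFst a α x (G (i + 1)) := by
    intro x
    by_cases hx : x ∈ Ioo 0 Real.pi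
    · rcases le_total x a with h | h
      · have h2 : x ∈ Icc 0 (a : ℝ) := ⟨hx.1.le, h⟩
        refine (eL h2).trans ?_
        simp only [Finset.sum_range_succ, hkm, zero_mul, add_zero]
        exact Finset.sum_congr rfl fun i hi =>
          congrArg _ (hG.left (i + 1) (Finset.mem_range.1 hi) h2).symm
      · have h2 : x ∈ Icc (a : ℝ) Real.pi := ⟨h, hx.2.le⟩
        refine (eR h2).trans ?_
        simp only [Finset.sum_range_succ, hkm, zero_mul, add_zero]
        exact Finset.sum_congr rfl fun i hi =>
          congrArg _ (hG.right (i + 1) (Finset.mem_range.1 hi) h2).symm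
    · have h0 : ∀ φ, evalFst a α x φ = 0 := fun φ => H01.eq_zero φ.1.1 hx
      simp [h0]
  refine ⟨k, waveDom_ext (fun x => ?_) fun x => ?_⟩
  · rw [hfst]
    simp only [map_sum, map_smul, smul_eq_mul]
  · refine (hψ1 x).trans ?_
    change z * evalFst a α x ψ + _ = _
    rw [hfst]
    simp only [map_sum, map_smul, smul_eq_mul]
    rw [Finset.sum_range_succ, hkm, zero_mul, add_zero, Finset.mul_sum, ← Finset.sum_add_distrib]
    refine Finset.sum_congr rfl fun i hi => ?_
    rw [hG.snd (i + 1) (Finset.mem_range.1 hi), Nat.add_sub_cancel]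
    ring

/-- `0` is not an eigenvalue: a formal eigenvector is `(c x, 0)`, without a jump of the slope
at `a`. -/
theorem not_isEigenvalue_zero (a : Ioo 0 Real.pi) (α : ℂ) :
    ¬ IsEigenvalue (waveOperator a α) 0 := by
  rintro ⟨⟨_, ⟨ψ, rfl⟩⟩, hne, hx⟩
  have h0 : waveAct a α ψ - (0 : ℂ) • waveIncl a α ψ = waveIncl a α 0 := by
    rw [map_zero, sub_eq_zero, ← waveOperator_apply a α ψ ⟨ψ, rfl⟩]
    exact hx
  obtain ⟨h1, h2⟩ := (waveAct_sub_smul_eq_iff a α 0 ψ 0).1 h0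
  have hψ2 : ∀ x, ψ.1.2 x = 0 := fun x => by
    rw [h1 x, zero_mul, zero_add]
    rfl
  have hode : ∀ᵐ x ∂(volume.restrict (Ioo 0 Real.pi)),
      deriv (deriv ψ.1.1) x = (0 : ℂ) ^ 2 * ψ.1.1 x + 0 := by
    filter_upwards [h2] with x hx
    rw [hx, zero_mul, zero_pow two_ne_zero, zero_mul]
    rfl
  set s := derivWithin ψ.1.1 (Icc 0 a) 0 with hs
  have hp1 : ∀ x : ℝ, HasDerivAt (fun x : ℝ => s * x) s x := fun x => by
    simpa using ((hasDerivAt_id (x : ℂ)).comp_ofReal).const_mul s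
  have hp : ContDiff ℝ 2 fun x : ℝ => s * x := contDiff_const.mul Complex.ofRealCLM.contDiff
  have haL : (a : ℝ) ∈ Icc 0 (a : ℝ) := right_mem_Icc.2 a.2.1.le
  have eL : EqOn ψ.1.1 (fun x : ℝ => s * x) (Icc 0 a) :=
    ψ.2.1.eqOn_of_ode a.2.1 0 hp hp1 (fun x => hasDerivAt_const x s) (f := fun _ => 0)
      (fun x _ => by simp)
      (ae_restrict_of_ae_restrict_of_subset (Ioo_subset_Ioo_right a.2.2.le) hode)
      (by simp [H01.eq_zero]) rfl
  have eR : EqOn ψ.1.1 (fun x : ℝ => s * x) (Icc a Real.pi) :=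
    ψ.2.2.1.eqOn_of_ode a.2.2 0 hp hp1 (fun x => hasDerivAt_const x s) (f := fun _ => 0)
      (fun x _ => by simp)
      (ae_restrict_of_ae_restrict_of_subset (Ioo_subset_Ioo_left a.2.1.le) hode)
      (eL haL) (by
        rw [sub_eq_iff_eq_add.1 ψ.2.2.2, hψ2, mul_zero, zero_add,
          derivWithin_eq_of_eqOn a.2.1 haL eL (hp1 a)])
  have hs0 : s = 0 := by
    have h := eR (right_mem_Icc.2 a.2.2.le)
    simp only [] at h
    rw [H01.eq_zero _ (by simp)] at h
    exact (mul_eq_zero.1 h.symm).resolve_right (by exact_mod_cast Real.pi_ne_zero)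
  have hψ : ψ = 0 := by
    refine waveDom_ext (fun x => ?_) hψ2
    change ψ.1.1 x = 0
    by_cases hx : x ∈ Ioo 0 Real.pi
    · rcases le_total x a with h | h
      · exact (eL ⟨hx.1.le, h⟩).trans (by simp [hs0])
      · exact (eR ⟨h, hx.2.le⟩).trans (by simp [hs0])
    · exact H01.eq_zero _ hx
  exact hne (by rw [hψ]; exact map_zero _)

end DampedWave

end

theorem mainTheorem2 (a : Set.Ioo (0 : ℝ) Real.pi) (α : ℂ) :
    Differentiable ℂ (DampedWave.charFun a α) ∧
    ∀ z : ℂ,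
      (DampedWave.IsEigenvalue (DampedWave.waveOperator a α) z ↔ DampedWave.charFun a α z = 0) ∧
      (DampedWave.IsEigenvalue (DampedWave.waveOperator a α) z →
        DampedWave.algebraicMultiplicity (DampedWave.waveOperator a α) z < ⊤ ∧
        DampedWave.algebraicMultiplicity (DampedWave.waveOperator a α) z =
          analyticOrderAt (DampedWave.charFun a α) z) := by
  refine ⟨DampedWave.differentiable_charFun a α, fun z => ?_⟩
  rcases eq_or_ne z 0 with rfl | hz
  · have h0 := DampedWave.not_isEigenvalue_zero a α
    refine ⟨iff_of_false h0 ?_, fun h => absurd h h0⟩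
    rw [DampedWave.charFun, if_pos rfl]
    exact_mod_cast Real.pi_ne_zero
  obtain ⟨m, hord, hπ, hπ'⟩ := DampedWave.exists_order_charFun a α hz
  obtain ⟨G, hG⟩ := DampedWave.exists_isTaylorFamily a α z hπ
  have hzero : DampedWave.charFun a α z = 0 ↔ m ≠ 0 := by
    rw [← ((DampedWave.differentiable_charFun a α).analyticAt z).analyticOrderAt_ne_zero, hord]
    simp
  -- `waveOperator a α` is `waveAct a α` in terms of the parametrization of its domain
  have happ : ∀ ψ, DampedWave.waveOperator a α ⟨DampedWave.waveIncl a α ψ, ⟨ψ, rfl⟩⟩ =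
      DampedWave.waveAct a α ψ := fun ψ => DampedWave.waveOperator_apply a α ψ _
  have hiff : DampedWave.IsEigenvalue (DampedWave.waveOperator a α) z ↔ m ≠ 0 := by
    constructor
    · rintro ⟨⟨_, ⟨ψ, rfl⟩⟩, hne, hx⟩ rfl
      obtain ⟨d, hd⟩ := hG.exists_eq_sum hz hπ hπ' ψ 0 (by
        have h : DampedWave.waveAct a α ψ = z • DampedWave.waveIncl a α ψ := (happ ψ).symm.trans hx
        simp [h])
      refine hne ?_
      rw [hd]
      simp
    · intro hm
      refine ⟨⟨DampedWave.waveIncl a α (G 1), ⟨G 1, rfl⟩⟩, fun h => ?_, ?_⟩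
      · refine hG.one_ne_zero (Nat.one_le_iff_ne_zero.2 hm) hz ?_
        exact DampedWave.waveIncl_injective a α (h.trans (map_zero _).symm)
      · have h := hG.waveAct_sub (Nat.one_le_iff_ne_zero.2 hm)
        rw [Nat.sub_self, hG.zero, map_zero, sub_eq_zero] at h
        exact (happ _).trans h
  refine ⟨hiff.trans hzero.symm, fun hev => ?_⟩
  have hm : 1 ≤ m := Nat.one_le_iff_ne_zero.2 (hiff.1 hev)
  have hmult : DampedWave.algebraicMultiplicity (DampedWave.waveOperator a α) z = m := by
    refine DampedWave.algebraicMultiplicity_eq_of_chain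
      (F := fun j => DampedWave.waveIncl a α (G j)) ?_ (fun h => ?_) (fun j _ => ⟨G j, rfl⟩)
      (fun j hj => ?_) ?_
    · simp [hG.zero]
    · exact hG.one_ne_zero hm hz (DampedWave.waveIncl_injective a α (h.trans (map_zero _).symm))
    · rw [happ]
      exact hG.waveAct_sub hj
    · rintro ⟨_, ⟨ψ, rfl⟩⟩ c hc
      rw [happ] at hc
      obtain ⟨d, hd⟩ := hG.exists_eq_sum hz hπ hπ' ψ c (by
        simpa only [map_sum, map_smul] using hc)
      refine ⟨d, ?_⟩
      simp only [← map_smul, ← map_sum, ← hd]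
  rw [hmult, hord]
  exact ⟨ENat.natCast_lt_top m, rfl⟩
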